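/- **Setting.** A *2-variable positive operator function* $G$ is a map defined on a non-empty set $\mathrm{dom}(G)$ of pairs $A=(A_1,A_2)$ of positive semi-definite operators on $\mathbb C^d$, $d=1,2,\dots$; write $\mathrm{dom}_d(G)$ for the pairs on $\mathbb C^d$. If $A\in\mathrm{dom}_d(G)$ then $G(A)$ is a positive semi-definite operator on $\mathbb C^d$, and for every unitary $V$ on $\mathbb C^d$, $(VA_1V^*,VA_2V^*)\in\mathrm{dom}_d(G)$ and $G(VA_1V^*,VA_2V^*)=VG(A_1,A_2)V^*$. By unitary covariance $G$ extends uniquely to pairs of operators on any finite-dimensional complex Hilbert space $\mathcal H$ that are unitarily equivalent to a pair in $\mathrm{dom}(G)$; the set of these pairs is $\mathrm{dom}_{\mathcal H}(G)$. Write $\mathrm{dom}(G)_{>0}$ for the pairs in $\mathrm{dom}(G)$ with $A_1,A_2$ positive definite, and $\mathrm{dom}_1(G)_{>0}$ for those on $\mathbb C^1$ (pairs of positive numbers). Operator inequalities are in the positive semi-definite order. We say that $G$ * is *strictly scalar positive* if $G(a)>0$ for all $a\in\mathrm{dom}_1(G)_{>0}$; * is *tensor multiplicative* if for all $d\ge1$,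 $A\in\mathrm{dom}_d(G)$ and $n\ge 1$, $(A_1^{\otimes n},A_2^{\otimes n})\in\mathrm{dom}_{(\mathbb C^d)^{\otimes n}}(G)$ and $G(A_1^{\otimes n},A_2^{\otimes n})=G(A)^{\otimes n}$; * is *scalar tensor multiplicative* if for all $a=(a_1,a_2)\in\mathrm{dom}_1(G)$ and $A\in\mathrm{dom}(G)$, $(a_1A_1,a_2A_2)\in\mathrm{dom}(G)$ and $G(a_1A_1,a_2A_2)=G(a)G(A)$; * is *asymptotically individually AM bounded* if for every $A\in\mathrm{dom}(G)$ there are finite positive measures $\mu_n$ on $\{1,2\}$, $n\ge1$, with $G(A)^{\otimes n}\le\mu_n(1)A_1^{\otimes n}+\mu_n(2)A_2^{\otimes n}$ for all $n\ge 1$ and $\limsup_{n\to\infty}\frac1n\log\mu_n(\{1,2\})\le0$; * is *block additive* if for all $r\ge1$ and $(A_i,B_i)\in\mathrm{dom}_{\mathcal H_i}(G)$, $i=1,\dots,r$, one has $(\bigoplus_iA_i,\bigoplus_iB_i)\in\mathrm{dom}_{\bigoplus_i\mathcal H_i}(G)$ and $G(\bigoplus_iA_i,\bigoplus_iB_i)=\bigoplus_iG(A_i,B_i)$;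 * has the *reduction property* if for every $A\in\mathrm{dom}_d(G)$ and every non-zero subspace $\mathcal K\subseteq\mathbb C^d$ invariant under $A_1$ and $A_2$, $(A_1|_{\mathcal K},A_2|_{\mathcal K})\in\mathrm{dom}_{\mathcal K}(G)$; * is *regular* if for every $(A_1,A_2)\in\mathrm{dom}(G)$ there is $\delta>0$ with $(A_1+\varepsilon I,A_2+\varepsilon I)\in\mathrm{dom}(G)$ for all $\varepsilon\in(0,\delta)$, and $G(A_1,A_2)=\lim_{\varepsilon\searrow0}G(A_1+\varepsilon I,A_2+\varepsilon I)$; * is a *$\nu$-weighted operator geometric mean*, for a probability distribution $\nu$ on $\{1,2\}$, if for every $d\ge 1$ and every commuting pair of positive definite operators $A_1,A_2$ on $\mathbb C^d$, $(A_1,A_2)\in\mathrm{dom}(G)$ and $G(A_1,A_2)=\exp(\nu(1)\log A_1+\nu(2)\log A_2)$. For $t\in[0,1]$, the $t$-weighted Kubo–Ando geometric mean is $B\#_tA:=B^{1/2}(B^{-1/2}AB^{-1/2})^tB^{1/2}$ for positive definite $A,B$, and $B\#_tA:=\lim_{\varepsilon\searrow0}(B+\varepsilon I)\#_t(A+\varepsilon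 I)$ for positive semi-definite $A,B$. **Theorem.** Let $G$ be a 2-variable positive operator function that is strictly scalar positive, tensor multiplicative, scalar tensor multiplicative, asymptotically individually AM bounded, block additive, and has the reduction property. (1) Suppose in addition that $\mathrm{dom}_1(G)_{>0}$ is closed under inversion: $(a_1,a_2)\in\mathrm{dom}_1(G)_{>0}$ implies $(a_1^{-1},a_2^{-1})\in\mathrm{dom}_1(G)$. (This holds, for example, if $\mathrm{dom}(G)$ contains all pairs of positive definite operators.) Then there is a $t\in[0,1]$ such that $G(A_1,A_2)=A_2\#_tA_1$ for every $(A_1,A_2)\in\mathrm{dom}(G)_{>0}$; if, moreover, $G$ is regular, then with the same $t$ this holds for every $(A_1,A_2)\in\mathrm{dom}(G)$. (2) If $G$ is a $\nu$-weighted operator geometric mean for a probability distribution $\nu$ on $\{1,2\}$, then $G(A_1,A_2)=A_2\#_{\nu(1)}A_1=G^{\mathrm{KA}}_\nu(A_1,A_2)$ for every $(A_1,A_2)\in\mathrm{dom}(G)_{>0}$, and for every $(A_1,A_2)\in\mathrm{dom}(G)$ if $G$ is regular. -/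

import Mathlib

open Filter Topology Set
open scoped NNReal ENNReal

noncomputable section

/-- The Hilbert space `ℂ^d`. -/
abbrev CSpace (d : ℕ) : Type := EuclideanSpace ℂ (Fin d)

/-- The algebra `B(H)` of bounded operators, with the Löwner order. -/
abbrev Op (H : Type) [NormedAddCommGroup H] [InnerProductSpace ℂ H] : Type := H →L[ℂ] H

section Hilbert

variable {H K L : Type} [NormedAddCommGroup H] [InnerProductSpace ℂ H]
  [NormedAddCommGroup K] [InnerProductSpace ℂ K] [NormedAddCommGroup L] [InnerProductSpace ℂ L]

/-- The conjugation `V A V*` of an operator `A` on `H` by a unitary `V : H → K`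
(for which `V* = V⁻¹`). -/
def unitaryConj (V : H ≃ₗᵢ[ℂ] K) (A : Op H) : Op K :=
  (V : H →L[ℂ] K) ∘L A ∘L (V.symm : K →L[ℂ] H)

@[simp] theorem unitaryConj_apply (V : H ≃ₗᵢ[ℂ] K) (A : Op H) (x : K) :
    unitaryConj V A x = V (A (V.symm x)) := rfl

theorem unitaryConj_trans (V : H ≃ₗᵢ[ℂ] K) (W : K ≃ₗᵢ[ℂ] L) (A : Op H) :
    unitaryConj W (unitaryConj V A) = unitaryConj (V.trans W) A := rfl

theorem unitaryConj_symm_self (V : H ≃ₗᵢ[ℂ] K) (A : Op H) :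
    unitaryConj V.symm (unitaryConj V A) = A := by
  ext x; simp

theorem unitaryConj_self_symm (V : H ≃ₗᵢ[ℂ] K) (A : Op K) :
    unitaryConj V (unitaryConj V.symm A) = A := by
  ext x; simp

end Hilbert

/-- The Hilbert space `(ℂ^d)^{⊗ n}`, in its coordinates with respect to the orthonormal basis
`e_{j 1} ⊗ ⋯ ⊗ e_{j n}`. -/
abbrev TensorSpace (d n : ℕ) : Type := EuclideanSpace ℂ (Fin n → Fin d)

/-- The product vector `v 1 ⊗ ⋯ ⊗ v n`. -/
def tensorVec {d n : ℕ} (v : Fin n → CSpace d) : TensorSpace d n :=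
  WithLp.toLp 2 fun i => ∏ k, v k (i k)

/-- The tensor power `A^{⊗ n}`, through its matrix elements
`⟨e_i, A^{⊗ n} e_j⟩ = ∏ k, ⟨e_{i k}, A e_{j k}⟩`. -/
def tensorPow {d : ℕ} (n : ℕ) (A : Op (CSpace d)) : Op (TensorSpace d n) :=
  Matrix.toEuclideanCLM (n := Fin n → Fin d) (𝕜 := ℂ)
    (Matrix.of fun i j => ∏ k, A (EuclideanSpace.single (j k) 1) (i k))

/-- `A^{⊗ n}` acts on product vectors as it should. -/
theorem tensorPow_tensorVec {d n : ℕ} (A : Op (CSpace d)) (v : Fin n → CSpace d) :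
    tensorPow n A (tensorVec v) = tensorVec fun k => A (v k) := by
  have key : ∀ (x : CSpace d) (i : Fin d),
      A x i = ∑ j, A (EuclideanSpace.single j 1) i * x j := by
    intro x i
    have hx : x = ∑ j, x j • EuclideanSpace.single j (1 : ℂ) := by
      ext l; simp [Pi.single_apply]
    conv_lhs => rw [hx]
    simp [map_sum, mul_comm]
  ext i
  simp only [tensorPow, tensorVec, Matrix.toEuclideanCLM_toLp, Matrix.mulVec, dotProduct,
    Matrix.of_apply]
  simp only [← Finset.prod_mul_distrib]
  simp_rw [key (v _)]
  rw [Finset.prod_univ_sum]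
  simp

/-- The direct sum `⊕ᵢ Aᵢ` on the Hilbert space direct sum `⊕ᵢ Hᵢ`. -/
def directSumOp {r : ℕ} {H : Fin r → Type} [∀ i, NormedAddCommGroup (H i)]
    [∀ i, InnerProductSpace ℂ (H i)] (A : ∀ i, Op (H i)) : Op (PiLp 2 H) :=
  ((PiLp.continuousLinearEquiv 2 ℂ H).symm : (∀ i, H i) →L[ℂ] PiLp 2 H) ∘L
    ContinuousLinearMap.piMap A ∘L
      ((PiLp.continuousLinearEquiv 2 ℂ H) : PiLp 2 H →L[ℂ] (∀ i, H i))

@[simp] theorem directSumOp_apply {r : ℕ} {H : Fin r → Type} [∀ i, NormedAddCommGroup (H i)]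
    [∀ i, InnerProductSpace ℂ (H i)] (A : ∀ i, Op (H i)) (x : PiLp 2 H) (i : Fin r) :
    directSumOp A x i = A i (x i) := rfl

/-- The scalar represented by an operator on the one-dimensional space `ℂ^1`. -/
def toScalar (a : Op (CSpace 1)) : ℂ := a (EuclideanSpace.single 0 1) 0

theorem toScalar_smul_one (z : ℂ) : toScalar (z • (1 : Op (CSpace 1))) = z := by
  simp [toScalar]

/-- A `Y`-variable positive operator function, for a set `Y` (with all its subsets as measurable
sets; the case used below is a two-point set). `dom d` is the set of those families of positive
semi-definite operators on `ℂ^d` on which the function is defined; the values of `toFun` outside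
of the domain carry no meaning. The natural numbers `d` start at `1`. -/
structure PositiveOperatorFunction (Y : Type) where
  dom : (d : ℕ) → Set (Y → Op (CSpace d))
  toFun : (d : ℕ) → (Y → Op (CSpace d)) → Op (CSpace d)
  dom_nonempty : ∃ d, (dom d).Nonempty
  dim_pos : ∀ {d : ℕ} {A : Y → Op (CSpace d)}, A ∈ dom d → 0 < d
  nonneg_of_mem_dom : ∀ {d : ℕ} {A : Y → Op (CSpace d)}, A ∈ dom d → ∀ y, 0 ≤ A y
  nonneg : ∀ {d : ℕ} {A : Y → Op (CSpace d)}, A ∈ dom d → 0 ≤ toFun d A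
  unitary_mem : ∀ {d : ℕ} {A : Y → Op (CSpace d)} (V : CSpace d ≃ₗᵢ[ℂ] CSpace d),
    A ∈ dom d → (fun y => unitaryConj V (A y)) ∈ dom d
  unitary_map : ∀ {d : ℕ} {A : Y → Op (CSpace d)} (V : CSpace d ≃ₗᵢ[ℂ] CSpace d),
    A ∈ dom d → toFun d (fun y => unitaryConj V (A y)) = unitaryConj V (toFun d A)

namespace PositiveOperatorFunction

variable {Y : Type} (G : PositiveOperatorFunction Y)

/-- The families in the domain that consist of positive definite operators. -/
def domPos (d : ℕ) : Set (Y → Op (CSpace d)) :=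
  {A | A ∈ G.dom d ∧ ∀ y, IsStrictlyPositive (A y)}

section Extension

variable (H : Type) [NormedAddCommGroup H] [InnerProductSpace ℂ H]

/-- The domain of the extension of `G` to operators on a finite-dimensional Hilbert space `H`. -/
def domOn : Set (Y → Op H) :=
  {A | ∃ (d : ℕ) (V : H ≃ₗᵢ[ℂ] CSpace d), (fun y => unitaryConj V (A y)) ∈ G.dom d}

variable {H}

theorem mem_dom_and_valOn_eq {d : ℕ} (V W : H ≃ₗᵢ[ℂ] CSpace d) (A : Y → Op H)
    (hA : (fun y => unitaryConj V (A y)) ∈ G.dom d) :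
    (fun y => unitaryConj W (A y)) ∈ G.dom d ∧
      unitaryConj W.symm (G.toFun d fun y => unitaryConj W (A y)) =
        unitaryConj V.symm (G.toFun d fun y => unitaryConj V (A y)) := by
  have e : ∀ y, unitaryConj (V.symm.trans W) (unitaryConj V (A y)) = unitaryConj W (A y) := by
    intro y; ext x; simp
  have h1 := G.unitary_mem (V.symm.trans W) hA
  have h2 := G.unitary_map (V.symm.trans W) hA
  simp only [e] at h1 h2
  refine ⟨h1, ?_⟩
  rw [h2]
  ext x; simp

theorem mem_domOn_iff {d : ℕ} (V : H ≃ₗᵢ[ℂ] CSpace d) (A : Y → Op H) :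
    A ∈ G.domOn H ↔ (fun y => unitaryConj V (A y)) ∈ G.dom d := by
  refine ⟨?_, fun h => ⟨d, V, h⟩⟩
  rintro ⟨d', W, hW⟩
  have hd : d' = d := by
    have h1 := W.toLinearEquiv.finrank_eq
    have h2 := V.toLinearEquiv.finrank_eq
    simp only [finrank_euclideanSpace, Fintype.card_fin] at h1 h2
    omega
  subst hd
  exact (G.mem_dom_and_valOn_eq W V A hW).1

variable [FiniteDimensional ℂ H]

/-- The extension of `G` to operators on a finite-dimensional Hilbert space `H`:
`G(A) = V* G(V A V*) V`, with `V` taken from a fixed orthonormal basis of `H`; by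
`mem_domOn_iff` and `valOn_eq`, every other unitary `V : H → ℂ^d` gives the same. -/
def valOn (A : Y → Op H) : Op H :=
  unitaryConj (stdOrthonormalBasis ℂ H).repr.symm
    (G.toFun (Module.finrank ℂ H) fun y => unitaryConj (stdOrthonormalBasis ℂ H).repr (A y))

theorem valOn_eq {d : ℕ} (V : H ≃ₗᵢ[ℂ] CSpace d) (A : Y → Op H) (hA : A ∈ G.domOn H) :
    G.valOn A = unitaryConj V.symm (G.toFun d fun y => unitaryConj V (A y)) := by
  have hd : Module.finrank ℂ H = d := by
    have h2 := V.toLinearEquiv.finrank_eq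
    simpa using h2
  subst hd
  exact (G.mem_dom_and_valOn_eq V _ A ((G.mem_domOn_iff V A).1 hA)).2

end Extension

/-- Strict scalar positivity. -/
def StrictlyScalarPositive : Prop :=
  ∀ a ∈ G.domPos 1, IsStrictlyPositive (G.toFun 1 a)

/-- Tensor multiplicativity: `A^{⊗ n}` is in the domain and `G(A^{⊗ n}) = G(A)^{⊗ n}`. -/
def TensorMultiplicative : Prop :=
  ∀ (d : ℕ), ∀ A ∈ G.dom d, ∀ n : ℕ, 1 ≤ n →
    (fun y => tensorPow n (A y)) ∈ G.domOn (TensorSpace d n) ∧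
      G.valOn (fun y => tensorPow n (A y)) = tensorPow n (G.toFun d A)

/-- Scalar tensor multiplicativity: `(a_y A_y)_y` is in the domain and `G(a A) = G(a) G(A)`. -/
def ScalarTensorMultiplicative : Prop :=
  ∀ a ∈ G.dom 1, ∀ (d : ℕ), ∀ A ∈ G.dom d,
    (fun y => toScalar (a y) • A y) ∈ G.dom d ∧
      G.toFun d (fun y => toScalar (a y) • A y) = toScalar (G.toFun 1 a) • G.toFun d A

/-- Asymptotic individual arithmetic mean boundedness: for every `A` in the domain there are
finite positive measures `μ n` on the finite set `Y` (given by their weights) with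
`G(A)^{⊗ n} ≤ ∫ A_y^{⊗ n} dμ n(y)` for all `n ≥ 1`, and `limsup (1/n) log μ n(Y) ≤ 0`. -/
def AsymptoticallyIndividuallyAMBounded [Fintype Y] : Prop :=
  ∀ (d : ℕ), ∀ A ∈ G.dom d, ∃ μ : ℕ → Y → ℝ≥0,
    (∀ n : ℕ, 1 ≤ n →
      tensorPow n (G.toFun d A) ≤ ∑ y, ((μ n y : ℝ) : ℂ) • tensorPow n (A y)) ∧
    limsup (fun n : ℕ => ENNReal.log (∑ y, (μ n y : ℝ≥0∞)) / (n : EReal)) atTop ≤ 0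

/-- Block additivity: a finite direct sum of families in the domain is in the domain, and
`G(⊕ᵢ Aᵢ) = ⊕ᵢ G(Aᵢ)`. -/
def BlockAdditive : Prop :=
  ∀ (r : ℕ), 1 ≤ r → ∀ (H : Fin r → Type) [∀ i, NormedAddCommGroup (H i)]
    [∀ i, InnerProductSpace ℂ (H i)] [∀ i, FiniteDimensional ℂ (H i)]
    (A : ∀ i, Y → Op (H i)), (∀ i, A i ∈ G.domOn (H i)) →
      (fun y => directSumOp fun i => A i y) ∈ G.domOn (PiLp 2 H) ∧
        G.valOn (fun y => directSumOp fun i => A i y) = directSumOp fun i => G.valOn (A i)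

/-- The reduction property: the domain is closed under restriction to non-zero subspaces that are
invariant under all members of the family. -/
def ReductionProperty : Prop :=
  ∀ (d : ℕ), ∀ A ∈ G.dom d, ∀ K : Submodule ℂ (CSpace d), K ≠ ⊥ →
    ∀ hK : ∀ y, MapsTo (A y) K K,
      (fun y => ((A y).restrict (hK y) : Op K)) ∈ G.domOn K

/-- Closedness of the positive scalar part of the domain under inversion: if the family of
positive numbers `(a_y)_y` is in the domain then so is `(1 / a_y)_y`. -/
def ScalarDomainInvClosed : Prop :=
  ∀ a : Y → ℝ, (∀ y, 0 < a y) →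
    (fun y => ((a y : ℝ) : ℂ) • (1 : Op (CSpace 1))) ∈ G.dom 1 →
    (fun y => (((a y)⁻¹ : ℝ) : ℂ) • (1 : Op (CSpace 1))) ∈ G.dom 1

/-- Regularity. -/
def Regular : Prop :=
  ∀ (d : ℕ), ∀ A ∈ G.dom d,
    (∃ δ : ℝ, 0 < δ ∧ ∀ ε ∈ Ioo 0 δ, (fun y => A y + (ε : ℂ) • 1) ∈ G.dom d) ∧
    Tendsto (fun ε : ℝ => G.toFun d fun y => A y + (ε : ℂ) • 1) (𝓝[>] 0) (𝓝 (G.toFun d A))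

/-- `G` is a `ν`-weighted operator geometric mean: every commuting family `A` of positive definite
operators is in the domain, with `G(A) = exp (∑ y, ν y • log (A y))`. -/
def IsWeightedGeometricMean [Fintype Y] (ν : Y → ℝ) : Prop :=
  ∀ (d : ℕ), 1 ≤ d → ∀ A : Y → Op (CSpace d), (∀ y, IsStrictlyPositive (A y)) →
    (∀ y z, Commute (A y) (A z)) →
      A ∈ G.dom d ∧ G.toFun d A = NormedSpace.exp (∑ y, (ν y : ℂ) • CFC.log (A y))

end PositiveOperatorFunction

/-- The `t`-weighted Kubo-Ando geometric mean `B #_t A` of positive definite operators. -/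
def kuboAndo {d : ℕ} (t : ℝ) (B A : Op (CSpace d)) : Op (CSpace d) :=
  B ^ (1 / 2 : ℝ) * (B ^ (-(1 / 2) : ℝ) * A * B ^ (-(1 / 2) : ℝ)) ^ t * B ^ (1 / 2 : ℝ)

/-- `X` is the `t`-weighted Kubo-Ando geometric mean `B #_t A` of the positive semi-definite
operators `A`, `B`, that is, `X = lim_{ε ↘ 0} (B + ε I) #_t (A + ε I)`. -/
def IsKuboAndo {d : ℕ} (t : ℝ) (B A X : Op (CSpace d)) : Prop :=
  Tendsto (fun ε : ℝ => kuboAndo t (B + (ε : ℂ) • 1) (A + (ε : ℂ) • 1)) (𝓝[>] 0) (𝓝 X)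

end

/-! Fix a positive definite pair and a basis `b` in which the form of `A 1` is the identity and the
form of `A 0` is diagonal with entries `x j`. The point is that the form `Z` of `G(A)` in this basis
is diagonal with entries `x j ^ t`.

Taking `n`-th roots in the asymptotic arithmetic mean bound gives `⟨φ, G(A) φ⟩ ≤ max_y ⟨φ, A_y φ⟩`
for every pair in the domain. Applied to tensor powers and products of basis vectors, it compares
products of the diagonal entries `y j` of `Z` with products of the `x j`, but only with nonnegative
exponents.

Determinants supply the negative ones. The antisymmetric vector is a joint eigenvector of the
`A_y^{⊗ d}` with eigenvalues `det A_y`, so block additivity and the reduction property turn tensor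
multiplicativity into `G(det A) = det G(A)` (`toScalar_toFun_det`). Closure under inversion then
permits division by powers of the determinants (`prod_inner_le`). Dividing once gives `∏ y j ≤ det
Z`, the reverse of Hadamard's inequality, so `Z` is diagonal. Dividing `n` times shifts every
exponent by `-n`, whence `∑ v j log (y j) ≤ max (∑ v j log (x j)) 0` for all integer vectors `v`. By
`exists_slope_of_le_max` this forces `y j = x j ^ t` with `t ∈ [0, 1]`.

The exponent does not depend on the pair, because two pairs can be compared inside their direct sum.
-/

noncomputable section

/-! ### The arithmetic mean bound tested on vectors -/

theorem inner_tensorVec {d n : ℕ} (v w : Fin n → CSpace d) :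
    inner ℂ (tensorVec v) (tensorVec w) = ∏ k, inner ℂ (v k) (w k) := by
  simp only [PiLp.inner_apply, tensorVec, Finset.prod_univ_sum, Fintype.piFinset_univ,
    RCLike.inner_apply, map_prod, Finset.prod_mul_distrib]

/-- A subexponential sequence does not dominate a growing geometric progression. -/
theorem le_one_of_pow_le_of_limsup_le {s : ℕ → ℝ≥0∞} {r : ℝ}
    (hs : limsup (fun n : ℕ => ENNReal.log (s n) / (n : EReal)) atTop ≤ 0)
    (h : ∀ n : ℕ, 1 ≤ n → ENNReal.ofReal (r ^ n) ≤ s n) : r ≤ 1 := by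
  by_contra! hr
  have hlog : 0 < Real.log r := Real.log_pos hr
  have key : ∀ n : ℕ, 1 ≤ n → ((Real.log r : ℝ) : EReal) ≤ ENNReal.log (s n) / (n : EReal) := by
    intro n hn
    have h1 := ENNReal.log_le_log (h n hn)
    have hn' : (0 : ℝ) < n := by exact_mod_cast hn
    rw [ENNReal.log_ofReal_of_pos (by positivity), Real.log_pow] at h1
    rw [EReal.le_div_iff_mul_le (by exact_mod_cast hn) (EReal.natCast_ne_top n)]
    refine le_trans (le_of_eq ?_) h1
    rw [mul_comm]
    push_cast
    rfl
  have h2 : ((Real.log r : ℝ) : EReal) ≤ 0 := by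
    refine le_trans ?_ hs
    refine le_trans ?_ liminf_le_limsup
    exact le_liminf_of_le (h := eventually_atTop.2 ⟨1, key⟩)
  exact absurd (EReal.coe_le_coe_iff.1 h2) (not_le.2 hlog)

namespace PositiveOperatorFunction

variable {Y : Type} {G : PositiveOperatorFunction Y}

/-- Tensor power trick: on `φ^{⊗ n}` the bound reads `u ^ n ≤ ∑ y, μ n y * p y ^ n`, and the
subexponential weights disappear after taking `n`-th roots. -/
theorem AsymptoticallyIndividuallyAMBounded.inner_le [Fintype Y]
    (hG : G.AsymptoticallyIndividuallyAMBounded) {d : ℕ} {A : Y → Op (CSpace d)}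
    (hA : A ∈ G.dom d) (φ : CSpace d) {u M : ℝ} {p : Y → ℝ}
    (hu : inner ℂ φ (G.toFun d A φ) = u) (hp : ∀ y, inner ℂ φ (A y φ) = p y)
    (hM : 0 ≤ M) (hpM : ∀ y, p y ≤ M) : u ≤ M := by
  -- `M` may be zero; a slightly larger `M'` can be divided by.
  refine le_of_forall_gt_imp_ge_of_dense fun M' hM' => ?_
  obtain ⟨μ, h1, h2⟩ := hG d A hA
  have hM'0 : 0 < M' := hM.trans_lt hM'
  have hp0 : ∀ y, 0 ≤ p y := by
    intro y
    have := ((ContinuousLinearMap.nonneg_iff_isPositive _).1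
      (G.nonneg_of_mem_dom hA y)).inner_nonneg_right φ
    rw [hp] at this
    exact_mod_cast this
  suffices u / M' ≤ 1 by rwa [div_le_one hM'0] at this
  refine le_one_of_pow_le_of_limsup_le h2 fun n hn => ?_
  have h3 := ((ContinuousLinearMap.le_def _ _).1 (h1 n hn)).inner_nonneg_right
    (tensorVec fun _ => φ)
  have h4 : 0 ≤ ∑ y, (μ n y : ℝ) * p y ^ n - u ^ n := by
    simp only [sub_apply, sum_apply, smul_apply, inner_sub_right, inner_sum,
      inner_smul_right, tensorPow_tensorVec, inner_tensorVec, hu, hp, Finset.prod_const,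
      Finset.card_univ, Fintype.card_fin] at h3
    exact_mod_cast h3
  have h5 : (u / M') ^ n ≤ ∑ y, (μ n y : ℝ) := by
    rw [div_pow, div_le_iff₀ (by positivity), Finset.sum_mul]
    refine (sub_nonneg.1 h4).trans (Finset.sum_le_sum fun y _ => ?_)
    have := hp0 y
    have := (hpM y).trans hM'.le
    gcongr
  refine (ENNReal.ofReal_le_ofReal h5).trans (le_of_eq ?_)
  rw [← NNReal.coe_sum, ENNReal.ofReal_coe_nnreal]
  push_cast
  rfl

theorem valOn_eq_toFun {d : ℕ} {A : Y → Op (CSpace d)} (hA : A ∈ G.dom d) :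
    G.valOn A = G.toFun d A :=
  G.valOn_eq (LinearIsometryEquiv.refl ℂ (CSpace d)) A
    ⟨d, LinearIsometryEquiv.refl ℂ (CSpace d), hA⟩

theorem AsymptoticallyIndividuallyAMBounded.inner_valOn_le [Fintype Y]
    (hG : G.AsymptoticallyIndividuallyAMBounded) {H : Type} [NormedAddCommGroup H]
    [InnerProductSpace ℂ H] [FiniteDimensional ℂ H] {A : Y → Op H}
    (hA : A ∈ G.domOn H) (φ : H) {u M : ℝ} {p : Y → ℝ}
    (hu : inner ℂ φ (G.valOn A φ) = u) (hp : ∀ y, inner ℂ φ (A y φ) = p y)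
    (hM : 0 ≤ M) (hpM : ∀ y, p y ≤ M) : u ≤ M := by
  obtain ⟨d, V, hV⟩ := hA
  refine hG.inner_le hV (V φ) ?_ (fun y => ?_) hM hpM
  · rw [← hu, G.valOn_eq V A ⟨d, V, hV⟩, unitaryConj_apply, LinearIsometryEquiv.symm_symm,
      ← V.inner_map_map φ, V.apply_symm_apply]
  · rw [← hp, unitaryConj_apply, V.symm_apply_apply, V.inner_map_map]

end PositiveOperatorFunction

/-! ### Determinants as eigenvalues of tensor powers -/

/-- The matrix of an operator on `ℂ^d` in the standard basis. -/
def opMatrix {d : ℕ} (A : Op (CSpace d)) : Matrix (Fin d) (Fin d) ℂ :=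
  Matrix.of fun i j => A (EuclideanSpace.single j 1) i

/-- The totally antisymmetric vector `∑ σ, sign σ • e_{σ 1} ⊗ ⋯ ⊗ e_{σ d}`. -/
def antisymmVec (d : ℕ) : TensorSpace d d :=
  ∑ σ : Equiv.Perm (Fin d), ((Equiv.Perm.sign σ : ℤ) : ℂ) •
    tensorVec fun k => EuclideanSpace.single (σ k) 1

theorem antisymmVec_apply {d : ℕ} (i : Fin d → Fin d) :
    antisymmVec d i = ((1 : Matrix (Fin d) (Fin d) ℂ).submatrix i id).det := by
  rw [← Matrix.det_transpose, Matrix.det_apply']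
  simp only [antisymmVec, WithLp.ofLp_sum, Finset.sum_apply, PiLp.smul_apply, tensorVec,
    smul_eq_mul]
  refine Finset.sum_congr rfl fun σ _ => ?_
  congr 1
  refine Finset.prod_congr rfl fun k _ => ?_
  simp [Matrix.one_apply]

theorem antisymmVec_ne_zero (d : ℕ) : antisymmVec d ≠ 0 := by
  intro h
  have := antisymmVec_apply (d := d) id
  rw [h] at this
  simp at this

/-- The coordinate at `i` of the left side is the Leibniz expansion of the determinant of the rows
`i` of `opMatrix A`. Selecting rows is left multiplication by a submatrix of the identity, so the
determinant factors, with no assumption on `A`. -/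
theorem tensorPow_antisymmVec {d : ℕ} (A : Op (CSpace d)) :
    tensorPow d A (antisymmVec d) = (opMatrix A).det • antisymmVec d := by
  ext i
  have h : (opMatrix A).submatrix i id =
      (1 : Matrix (Fin d) (Fin d) ℂ).submatrix i id * opMatrix A := by
    ext a b; simp [Matrix.mul_apply, Matrix.one_apply]
  rw [PiLp.smul_apply, antisymmVec_apply, smul_eq_mul, mul_comm, ← Matrix.det_mul, ← h,
    ← Matrix.det_transpose, Matrix.det_apply', antisymmVec]
  simp only [map_sum, map_smul, tensorPow_tensorVec]
  simp only [WithLp.ofLp_sum, Finset.sum_apply, PiLp.smul_apply, tensorVec, smul_eq_mul]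
  rfl

theorem op_cspace_one_eq (A : Op (CSpace 1)) : A = toScalar A • 1 := by
  ext x i
  have hx : x = x 0 • EuclideanSpace.single 0 (1 : ℂ) := by
    ext l; fin_cases l; simp
  have hi : i = 0 := Subsingleton.elim _ _
  subst hi
  conv_lhs => rw [hx]
  simp [toScalar, mul_comm]

theorem unitaryConj_smul_one {H K : Type} [NormedAddCommGroup H] [InnerProductSpace ℂ H]
    [NormedAddCommGroup K] [InnerProductSpace ℂ K] (V : H ≃ₗᵢ[ℂ] K) (z : ℂ) :
    unitaryConj V (z • 1) = z • 1 := by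
  ext x; simp

/-! ### Direct sums, invariant subspaces and joint eigenvectors -/

namespace PositiveOperatorFunction

variable {Y : Type} {G : PositiveOperatorFunction Y}

theorem valOn_unitaryConj {H K : Type} [NormedAddCommGroup H] [InnerProductSpace ℂ H]
    [FiniteDimensional ℂ H] [NormedAddCommGroup K] [InnerProductSpace ℂ K]
    [FiniteDimensional ℂ K] (V : H ≃ₗᵢ[ℂ] K) {A : Y → Op H} (hA : A ∈ G.domOn H) :
    (fun y => unitaryConj V (A y)) ∈ G.domOn K ∧
      G.valOn (fun y => unitaryConj V (A y)) = unitaryConj V (G.valOn A) := by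
  obtain ⟨d, W, hW⟩ := hA
  have e : (fun y => unitaryConj (V.symm.trans W) (unitaryConj V (A y))) =
      fun y => unitaryConj W (A y) := by
    funext y; ext x; simp
  have h1 : (fun y => unitaryConj V (A y)) ∈ G.domOn K := ⟨d, V.symm.trans W, by rwa [e]⟩
  refine ⟨h1, ?_⟩
  rw [G.valOn_eq (V.symm.trans W) _ h1, e, G.valOn_eq W A ⟨d, W, hW⟩]
  rfl

theorem valOn_apply_single (hblock : G.BlockAdditive) {r : ℕ} {H : Fin r → Type}
    [∀ i, NormedAddCommGroup (H i)] [∀ i, InnerProductSpace ℂ (H i)]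
    [∀ i, FiniteDimensional ℂ (H i)] {B : ∀ i, Y → Op (H i)} (hB : ∀ i, B i ∈ G.domOn (H i))
    (i : Fin r) (x : H i) :
    G.valOn (fun y => directSumOp fun i => B i y) (PiLp.single 2 i x) =
      PiLp.single 2 i (G.valOn (B i) x) := by
  rw [(hblock r (Fin.pos i) H B hB).2]
  ext1 j
  rw [directSumOp_apply]
  rcases eq_or_ne j i with rfl | hj
  · simp
  · simp [Pi.single_eq_of_ne hj]

theorem toFun_apply_of_directSum (hblock : G.BlockAdditive) {d r : ℕ} {A : Y → Op (CSpace d)}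
    (hA : A ∈ G.dom d) {H : Fin r → Type} [∀ i, NormedAddCommGroup (H i)]
    [∀ i, InnerProductSpace ℂ (H i)] [∀ i, FiniteDimensional ℂ (H i)]
    {B : ∀ i, Y → Op (H i)} (hB : ∀ i, B i ∈ G.domOn (H i)) (U : CSpace d ≃ₗᵢ[ℂ] PiLp 2 H)
    (hU : ∀ y w, A y (U.symm w) = U.symm (directSumOp (fun i => B i y) w)) (i : Fin r) (x : H i) :
    G.toFun d A (U.symm (PiLp.single 2 i x)) = U.symm (PiLp.single 2 i (G.valOn (B i) x)) := by
  have h1 := (hblock r (Fin.pos i) H B hB).1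
  have h3 : (fun y => unitaryConj U.symm (directSumOp fun i => B i y)) = A := by
    funext y; ext1 v
    rw [unitaryConj_apply, ← hU, LinearIsometryEquiv.symm_symm, U.symm_apply_apply]
  have h4 := (valOn_unitaryConj U.symm h1).2
  rw [h3, valOn_eq_toFun hA] at h4
  rw [h4, unitaryConj_apply, LinearIsometryEquiv.symm_symm, U.apply_symm_apply,
    valOn_apply_single hblock hB]

/-- The value of a block additive function with the reduction property maps every member of an
orthogonal decomposition into invariant subspaces to itself, and restricts there to the value at
the restriction. -/
theorem toFun_apply_of_isInternal (hblock : G.BlockAdditive) (hred : G.ReductionProperty)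
    {d r : ℕ} {A : Y → Op (CSpace d)} (hA : A ∈ G.dom d) {F : Fin r → Submodule ℂ (CSpace d)}
    (hF0 : ∀ i, F i ≠ ⊥) (horth : OrthogonalFamily ℂ (fun i => F i) fun i => (F i).subtypeₗᵢ)
    (hint : DirectSum.IsInternal F) (hF : ∀ i y, MapsTo (A y) (F i) (F i)) (i : Fin r) (x : F i) :
    G.toFun d A x = (G.valOn (fun y => ((A y).restrict (hF i y) : Op (F i))) x : F i) := by
  obtain ⟨U, hU⟩ : ∃ U : CSpace d ≃ₗᵢ[ℂ] PiLp 2 fun i => F i,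
      ∀ w, U.symm w = ∑ i, (w i : CSpace d) :=
    ⟨hint.isometryL2OfOrthogonalFamily horth,
      hint.isometryL2OfOrthogonalFamily_symm_apply horth⟩
  have hsingle : ∀ z : F i, U.symm (PiLp.single 2 i z) = z := by
    intro z
    rw [hU, Finset.sum_eq_single i]
    · simp
    · intro j _ hj
      simp [Pi.single_eq_of_ne hj]
    · simp
  have hUA : ∀ y w, A y (U.symm w) =
      U.symm (directSumOp (fun i => ((A y).restrict (hF i y) : Op (F i))) w) := by
    intro y w
    rw [hU, hU, map_sum]
    rfl
  have h := toFun_apply_of_directSum hblock hA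
    (fun i => hred d A hA (F i) (hF0 i) (hF i)) U hUA i x
  rwa [hsingle, hsingle] at h

/-- The members of the family are self-adjoint, so `Kᗮ` is invariant too and the space splits into
two blocks. -/
theorem toFun_apply_of_invariant (hblock : G.BlockAdditive) (hred : G.ReductionProperty)
    {d : ℕ} {A : Y → Op (CSpace d)} (hA : A ∈ G.dom d) {K : Submodule ℂ (CSpace d)} (hK0 : K ≠ ⊥)
    (hK : ∀ y, MapsTo (A y) K K) (x : K) :
    G.toFun d A x = (G.valOn (fun y => ((A y).restrict (hK y) : Op K)) x : K) := by
  -- The reduction property speaks only of non-zero subspaces, so `K = ⊤` is treated apart.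
  by_cases hperp : Kᗮ = ⊥
  · obtain rfl : K = ⊤ := (Submodule.orthogonal_eq_bot_iff).1 hperp
    rw [G.valOn_eq (LinearIsometryEquiv.ofTop (CSpace d) ⊤ rfl) _ (hred d A hA ⊤ hK0 hK)]
    rfl
  have hKperp : ∀ y, MapsTo (A y) Kᗮ Kᗮ := by
    intro y v hv
    have hs := ((ContinuousLinearMap.nonneg_iff_isPositive _).1
      (G.nonneg_of_mem_dom hA y)).isSymmetric
    intro w hw
    exact (hs w v).symm.trans (hv _ (hK y hw))
  have horth : OrthogonalFamily ℂ (fun i => (![K, Kᗮ] : Fin 2 → Submodule ℂ (CSpace d)) i)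
      fun i => (![K, Kᗮ] i).subtypeₗᵢ := by
    refine OrthogonalFamily.of_pairwise ?_
    intro i j hij
    fin_cases i <;> fin_cases j
    · exact absurd rfl hij
    · exact Submodule.isOrtho_orthogonal_right K
    · exact Submodule.isOrtho_orthogonal_left K
    · exact absurd rfl hij
  have hint : DirectSum.IsInternal ![K, Kᗮ] := by
    rw [horth.isInternal_iff, Submodule.orthogonal_eq_bot_iff, eq_top_iff,
      ← Submodule.sup_orthogonal_of_hasOrthogonalProjection (K := K)]
    exact sup_le (le_iSup ![K, Kᗮ] 0) (le_iSup ![K, Kᗮ] 1)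
  refine toFun_apply_of_isInternal hblock hred hA (F := ![K, Kᗮ]) ?_ horth hint ?_ 0 x
  · intro i; fin_cases i
    exacts [hK0, hperp]
  · intro i; fin_cases i
    exacts [hK, hKperp]

/-- A joint eigenvector spans an invariant line, on which the family is a scalar family. -/
theorem toFun_apply_eigenvector (hblock : G.BlockAdditive) (hred : G.ReductionProperty)
    {d : ℕ} {A : Y → Op (CSpace d)} (hA : A ∈ G.dom d) {ω : CSpace d} (hω : ω ≠ 0) {a : Y → ℂ}
    (h : ∀ y, A y ω = a y • ω) :
    (fun y => a y • (1 : Op (CSpace 1))) ∈ G.dom 1 ∧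
      G.toFun d A ω = toScalar (G.toFun 1 fun y => a y • 1) • ω := by
  let K : Submodule ℂ (CSpace d) := ℂ ∙ ω
  have hK0 : K ≠ ⊥ := by simpa [K] using hω
  have hK : ∀ y, MapsTo (A y) K K := by
    intro y v hv
    obtain ⟨c, rfl⟩ := Submodule.mem_span_singleton.1 hv
    rw [map_smul, h]
    exact K.smul_mem _ (K.smul_mem _ (Submodule.mem_span_singleton_self ω))
  have hdim : Module.finrank ℂ K = 1 := finrank_span_singleton hω
  let V : K ≃ₗᵢ[ℂ] CSpace 1 :=
    (stdOrthonormalBasis ℂ K).repr.trans (LinearIsometryEquiv.piLpCongrLeft 2 ℂ ℂ (finCongr hdim))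
  have hR : ∀ y, ((A y).restrict (hK y) : Op K) = a y • 1 := by
    intro y; ext1 v
    obtain ⟨v, hv⟩ := v
    obtain ⟨c, rfl⟩ := Submodule.mem_span_singleton.1 hv
    refine Subtype.ext ?_
    change A y (c • ω) = a y • c • ω
    rw [map_smul, h, smul_comm]
  have hdom := hred d A hA K hK0 hK
  have hval := toFun_apply_of_invariant hblock hred hA hK0 hK
    ⟨ω, Submodule.mem_span_singleton_self ω⟩
  simp only [hR] at hdom hval
  refine ⟨?_, ?_⟩
  · have := (G.mem_domOn_iff V _).1 hdom
    simpa only [unitaryConj_smul_one] using this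
  · rw [G.valOn_eq V _ hdom] at hval
    simp only [unitaryConj_smul_one] at hval
    rw [op_cspace_one_eq (G.toFun 1 _), unitaryConj_smul_one] at hval
    simpa using hval

theorem valOn_apply_eigenvector (hblock : G.BlockAdditive) (hred : G.ReductionProperty)
    {H : Type} [NormedAddCommGroup H] [InnerProductSpace ℂ H] [FiniteDimensional ℂ H]
    {A : Y → Op H} (hA : A ∈ G.domOn H) {ω : H} (hω : ω ≠ 0) {a : Y → ℂ}
    (h : ∀ y, A y ω = a y • ω) :
    (fun y => a y • (1 : Op (CSpace 1))) ∈ G.dom 1 ∧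
      G.valOn A ω = toScalar (G.toFun 1 fun y => a y • 1) • ω := by
  obtain ⟨d, V, hV⟩ := hA
  obtain ⟨h1, h2⟩ := toFun_apply_eigenvector hblock hred hV (ω := V ω) (by simpa using hω) (a := a)
    (fun y => by simp [h])
  refine ⟨h1, ?_⟩
  rw [G.valOn_eq V A ⟨d, V, hV⟩, unitaryConj_apply, LinearIsometryEquiv.symm_symm, h2]
  simp

/-- Multiplicativity under tensor powers passes to determinants. -/
theorem toScalar_toFun_det (htens : G.TensorMultiplicative) (hblock : G.BlockAdditive)
    (hred : G.ReductionProperty) {d : ℕ} {A : Y → Op (CSpace d)} (hA : A ∈ G.dom d) :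
    (fun y => (opMatrix (A y)).det • (1 : Op (CSpace 1))) ∈ G.dom 1 ∧
      toScalar (G.toFun 1 fun y => (opMatrix (A y)).det • 1) = (opMatrix (G.toFun d A)).det := by
  -- The `d`-th tensor power is the one that contains the antisymmetric vector.
  obtain ⟨h1, h2⟩ := htens d A hA d (G.dim_pos hA)
  obtain ⟨h3, h4⟩ := valOn_apply_eigenvector hblock hred h1 (antisymmVec_ne_zero d)
    (fun y => tensorPow_antisymmVec (A y))
  refine ⟨h3, ?_⟩
  rw [h2, tensorPow_antisymmVec] at h4
  exact (smul_left_injective ℂ (antisymmVec_ne_zero d) h4).symm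

end PositiveOperatorFunction

/-! ### Additive functionals and equality in Hadamard's inequality -/

/-- An additive functional bounded by the positive part of another one is a multiple of it. -/
theorem exists_slope_of_le_max {M : Type} [AddCommGroup M] (f l : M →+ ℝ)
    (h : ∀ v, f v ≤ max (l v) 0) : ∃ t ∈ Set.Icc (0 : ℝ) 1, ∀ v, f v = t * l v := by
  by_cases hl : ∀ v, l v ≤ 0
  · have hf : ∀ v, f v ≤ 0 := fun v => (h v).trans (max_le (hl v) le_rfl)
    refine ⟨0, by simp, fun v => ?_⟩
    have := hf (-v)
    rw [map_neg] at this
    linarith [hf v]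
  push Not at hl
  obtain ⟨e, he⟩ := hl
  have h1 : f e ≤ l e := by simpa [he.le] using h e
  have h2 : 0 ≤ f e := by
    have := h (-e)
    rw [map_neg, map_neg, max_eq_right (by linarith)] at this
    linarith
  have key : ∀ v, f v ≤ f e / l e * l v := by
    intro v
    by_contra! hv
    obtain ⟨n, hn⟩ := exists_nat_gt (l e / (f v - f e / l e * l v))
    rw [div_lt_iff₀ (by linarith)] at hn
    -- With this `m`, `l (n • v - m • e)` lies in `[0, l e)`, while `f (n • v - m • e)` is at least
    -- `n` times the assumed excess, which exceeds `l e` by the choice of `n`.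
    let m : ℤ := ⌊n * l v / l e⌋
    have hm1 : m * l e ≤ n * l v := (le_div_iff₀ he).1 (Int.floor_le _)
    have hm2 : n * l v < (m + 1) * l e := (div_lt_iff₀ he).1 (Int.lt_floor_add_one _)
    have h3 := h (n • v - m • e)
    rw [map_sub, map_sub, map_nsmul, map_nsmul, map_zsmul, map_zsmul, nsmul_eq_mul, nsmul_eq_mul,
      zsmul_eq_mul, zsmul_eq_mul, max_eq_left (by linarith)] at h3
    have h4 : m * f e ≤ f e / l e * (n * l v) := by
      have := mul_le_mul_of_nonneg_left hm1 (div_nonneg h2 he.le)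
      calc m * f e = f e / l e * (m * l e) := by field_simp
        _ ≤ _ := this
    linarith
  refine ⟨f e / l e, ⟨by positivity, (div_le_one he).2 h1⟩, fun v => le_antisymm (key v) ?_⟩
  have := key (-v)
  rw [map_neg, map_neg] at this
  linarith

-- Equality in the AM-GM inequality for the eigenvalues: their sum is the dimension and their
-- product is at least one, so the nonnegative terms `λ - 1 - log λ` have sum at most zero, and each
-- vanishes only at `λ = 1`.
open scoped ComplexOrder in
theorem Matrix.PosSemidef.eq_one_of_one_le_det {n : Type} [Fintype n] [DecidableEq n]
    {Z : Matrix n n ℂ} (hZ : Z.PosSemidef) (hdiag : ∀ i, Z i i = 1) (hdet : 1 ≤ Z.det) :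
    Z = 1 := by
  have hH := hZ.isHermitian
  have h0 := hZ.eigenvalues_nonneg
  have hprod : 1 ≤ ∏ i, hH.eigenvalues i := by
    have : (1 : ℂ) ≤ ((∏ i, hH.eigenvalues i : ℝ) : ℂ) := by
      rw [Complex.ofReal_prod]
      exact hdet.trans_eq hH.det_eq_prod_eigenvalues
    exact_mod_cast this
  have hsum : ∑ i, hH.eigenvalues i = Fintype.card n := by
    have h1 : Z.trace = Fintype.card n := by simp [Matrix.trace, hdiag]
    have h2 : ((∑ i, hH.eigenvalues i : ℝ) : ℂ) = Fintype.card n := by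
      rw [Complex.ofReal_sum, ← h1]
      exact hH.trace_eq_sum_eigenvalues.symm
    exact_mod_cast h2
  have hne : ∀ i, hH.eigenvalues i ≠ 0 := fun i hi => by
    rw [Finset.prod_eq_zero (Finset.mem_univ i) hi] at hprod
    linarith
  have hpos : ∀ i, 0 < hH.eigenvalues i := fun i => (h0 i).lt_of_ne' (hne i)
  have hlog : ∀ i, 0 ≤ hH.eigenvalues i - 1 - Real.log (hH.eigenvalues i) := fun i => by
    linarith [Real.log_le_sub_one_of_pos (hpos i)]
  have hle : ∑ i, (hH.eigenvalues i - 1 - Real.log (hH.eigenvalues i)) ≤ 0 := by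
    rw [Finset.sum_sub_distrib, Finset.sum_sub_distrib, hsum, ← Real.log_prod fun i _ => hne i]
    have := Real.log_nonneg hprod
    simpa using this
  have hone : ∀ i, hH.eigenvalues i = 1 := by
    intro i
    by_contra hi
    have := (Finset.sum_eq_zero_iff_of_nonneg fun i _ => hlog i).1
      (le_antisymm hle (Finset.sum_nonneg fun i _ => hlog i)) i (Finset.mem_univ i)
    linarith [Real.log_lt_sub_one_of_pos (hpos i) hi]
  have hspec := hH.spectral_theorem
  have hd : (Matrix.diagonal (RCLike.ofReal ∘ hH.eigenvalues) : Matrix n n ℂ) = 1 := by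
    rw [← Matrix.diagonal_one]
    congr 1
    funext i
    simp [hone]
  rw [hspec, hd, map_one]

open scoped ComplexOrder in
/-- The equality case of Hadamard's determinant inequality. -/
theorem Matrix.PosSemidef.eq_diagonal_of_prod_le_det {n : Type} [Fintype n] [DecidableEq n]
    {Z : Matrix n n ℂ} (hZ : Z.PosSemidef) {y : n → ℝ} (hy : ∀ i, 0 < y i)
    (hdiag : ∀ i, Z i i = y i) (hdet : ((∏ i, y i : ℝ) : ℂ) ≤ Z.det) :
    Z = Matrix.diagonal fun i => (y i : ℂ) := by
  -- Congruence by `E` normalises the diagonal to one.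
  let E : Matrix n n ℂ := Matrix.diagonal fun i => ((√(y i))⁻¹ : ℝ)
  have hE : E.conjTranspose = E := by
    simp only [E, Matrix.diagonal_conjTranspose]
    congr 1
    funext i
    simp
  have hs : ∀ i, (√(y i))⁻¹ * y i * (√(y i))⁻¹ = 1 := by
    intro i
    have h1 := Real.mul_self_sqrt (hy i).le
    have h2 := (Real.sqrt_pos.2 (hy i)).ne'
    field_simp
    nlinarith [h1]
  have hps : (E * Z * E).PosSemidef := by
    have := hZ.conjTranspose_mul_mul_same E
    rwa [hE] at this
  have hentry : ∀ i j, (E * Z * E) i j = ((√(y i))⁻¹ : ℝ) * Z i j * ((√(y j))⁻¹ : ℝ) := by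
    intro i j
    simp [E, Matrix.mul_diagonal, Matrix.diagonal_mul]
  have hone : E * Z * E = 1 := by
    refine hps.eq_one_of_one_le_det (fun i => ?_) ?_
    · rw [hentry, hdiag]
      exact_mod_cast hs i
    · have hEdet : E.det = ((∏ i, (√(y i))⁻¹ : ℝ) : ℂ) := by
        simp [E, Matrix.det_diagonal]
      rw [Matrix.det_mul, Matrix.det_mul, hEdet]
      have hp : (0 : ℂ) ≤ ((∏ i, (√(y i))⁻¹ : ℝ) : ℂ) := by
        exact_mod_cast Finset.prod_nonneg fun i _ => inv_nonneg.2 (Real.sqrt_nonneg _)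
      refine le_trans (le_of_eq ?_)
        (mul_le_mul_of_nonneg_right (mul_le_mul_of_nonneg_left hdet hp) hp)
      rw [← Complex.ofReal_mul, ← Complex.ofReal_mul, ← Finset.prod_mul_distrib,
        ← Finset.prod_mul_distrib, Finset.prod_eq_one fun i _ => hs i, Complex.ofReal_one]
  ext i j
  rcases eq_or_ne i j with rfl | hij
  · simp [hdiag]
  · have h1 := hentry i j
    have h2 : ∀ i, (((√(y i))⁻¹ : ℝ) : ℂ) ≠ 0 := fun i =>
      Complex.ofReal_ne_zero.2 (inv_pos.2 (Real.sqrt_pos.2 (hy i))).ne'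
    rw [hone, Matrix.one_apply_ne hij, zero_eq_mul, or_iff_left (h2 j), mul_eq_zero,
      or_iff_right (h2 i)] at h1
    rw [h1, Matrix.diagonal_apply_ne _ hij]

/-! ### Simultaneous diagonalisation of two forms -/

/-- The matrix of the sesquilinear form of `T` in the family `w`. -/
def formMatrix {d : ℕ} (T : Op (CSpace d)) (w : Fin d → CSpace d) : Matrix (Fin d) (Fin d) ℂ :=
  Matrix.of fun i j => inner ℂ (w i) (T (w j))

theorem formMatrix_eq {d : ℕ} (T : Op (CSpace d)) (w : Fin d → CSpace d) :
    formMatrix T w = (Matrix.of fun i j => w j i).conjTranspose * opMatrix T *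
      Matrix.of fun i j => w j i := by
  ext i j
  have hj : w j = ∑ l, w j l • EuclideanSpace.single l (1 : ℂ) := by
    ext l; simp [Pi.single_apply]
  simp only [formMatrix, Matrix.of_apply]
  conv_lhs => rw [hj]
  simp only [map_sum, map_smul, inner_sum, inner_smul_right, Matrix.mul_apply,
    Matrix.conjTranspose_apply, Matrix.of_apply, opMatrix, PiLp.inner_apply, RCLike.inner_apply]
  refine Finset.sum_congr rfl fun l _ => ?_
  rw [mul_comm]
  congr 1
  refine Finset.sum_congr rfl fun k _ => ?_
  rw [mul_comm]
  rfl

theorem det_formMatrix {d : ℕ} (T : Op (CSpace d)) (w : Fin d → CSpace d) :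
    (formMatrix T w).det =
      (Complex.normSq (Matrix.det (Matrix.of fun i j => w j i)) : ℂ) * (opMatrix T).det := by
  rw [formMatrix_eq, Matrix.det_mul, Matrix.det_mul, Matrix.det_conjTranspose,
    ← Complex.mul_conj, starRingEnd_apply]
  ring

open scoped ComplexOrder in
theorem posSemidef_formMatrix {d : ℕ} {T : Op (CSpace d)} (hT : 0 ≤ T) (w : Fin d → CSpace d) :
    (formMatrix T w).PosSemidef := by
  have hp := (ContinuousLinearMap.nonneg_iff_isPositive _).1 hT
  refine .of_dotProduct_mulVec_nonneg ?_ fun x => ?_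
  · ext i j
    simp only [Matrix.conjTranspose_apply, formMatrix, Matrix.of_apply]
    rw [← starRingEnd_apply, inner_conj_symm]
    exact hp.isSymmetric _ _
  · refine (hp.inner_nonneg_right (∑ i, x i • w i)).trans (le_of_eq ?_)
    simp only [map_sum, map_smul, sum_inner, inner_sum, inner_smul_left, inner_smul_right,
      dotProduct, Matrix.mulVec, formMatrix, Matrix.of_apply, Finset.mul_sum]
    rw [Finset.sum_comm]
    refine Finset.sum_congr rfl fun i _ => Finset.sum_congr rfl fun j _ => ?_
    rw [Pi.star_apply, ← starRingEnd_apply]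
    ring

/-- The spectrum is finite, so `f` may be replaced by an interpolating polynomial. -/
theorem cfc_apply_eigenvector {H : Type} [NormedAddCommGroup H] [InnerProductSpace ℂ H]
    [FiniteDimensional ℂ H] [CompleteSpace H] {T : Op H} (hT : IsSelfAdjoint T) (f : ℝ → ℝ)
    {v : H} {x : ℝ} (hv : T v = (x : ℂ) • v) : cfc f T v = (f x : ℂ) • v := by
  have hfin : (spectrum ℝ T).Finite := by
    rw [← spectrum.preimage_algebraMap ℂ, ContinuousLinearMap.spectrum_eq]
    exact (Module.End.finite_spectrum _).preimage (FaithfulSMul.algebraMap_injective ℝ ℂ).injOn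
  -- Adding `x` as a node covers `v = 0`, where `x` need not lie in the spectrum.
  let s : Finset ℝ := insert x hfin.toFinset
  let p : Polynomial ℝ := Lagrange.interpolate s id f
  have hp : ∀ z ∈ s, p.eval z = f z := fun z hz =>
    Lagrange.eval_interpolate_at_node f (Set.injOn_id _) hz
  have h1 : cfc f T = Polynomial.aeval T p := by
    rw [← cfc_polynomial p T hT]
    refine cfc_congr fun z hz => (hp z ?_).symm
    exact Finset.mem_insert_of_mem (hfin.mem_toFinset.2 hz)
  have h2 : ∀ q : Polynomial ℝ, Polynomial.aeval T q v = ((q.eval x : ℝ) : ℂ) • v := by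
    intro q
    induction q using Polynomial.induction_on' with
    | add q r hq hr => simp [hq, hr, add_smul]
    | monomial n a =>
      have hpow : ∀ n : ℕ, (T ^ n) v = ((x : ℂ) ^ n) • v := by
        intro n
        induction n with
        | zero => simp
        | succ n ih => rw [pow_succ', mul_apply_eq_comp, ih, map_smul, hv, smul_smul,
            pow_succ]
      rw [Polynomial.aeval_monomial, Polynomial.eval_monomial, mul_apply_eq_comp,
        hpow, Complex.ofReal_mul, Complex.ofReal_pow, mul_smul, Algebra.algebraMap_eq_smul_one,
        smul_comm (a : ℂ)]
      simp
  rw [h1, h2, hp x (Finset.mem_insert_self _ _)]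

/-- Take `b j = B^{-1/2} e j` for an orthonormal eigenbasis `e` of `B^{-1/2} A B^{-1/2}`; then `B (b
j) = B^{1/2} e j`, and the three claims follow from the eigenvalue equation. -/
theorem exists_basis_simultaneous {d : ℕ} {B A : Op (CSpace d)} (hB : IsStrictlyPositive B)
    (hA : 0 ≤ A) :
    ∃ (b : Module.Basis (Fin d) ℂ (CSpace d)) (x : Fin d → ℝ), formMatrix B b = 1 ∧
      (∀ j, A (b j) = (x j : ℂ) • B (b j)) ∧
      ∀ (t : ℝ) (j : Fin d), kuboAndo t B A (b j) = ((x j ^ t : ℝ) : ℂ) • B (b j) := by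
  set R : Op (CSpace d) := B ^ (-(1 / 2) : ℝ) with hR
  set S : Op (CSpace d) := B ^ (1 / 2 : ℝ) with hS
  have hRS : R * S = 1 := CFC.rpow_neg_mul_rpow _ hB
  have hSR : S * R = 1 := CFC.rpow_mul_rpow_neg _ hB
  have hSS : S * S = B := by
    rw [hS, ← CFC.rpow_add hB.isUnit, show (1 / 2 + 1 / 2 : ℝ) = 1 by norm_num,
      CFC.rpow_one B hB.nonneg]
  have hR0 : 0 ≤ R := CFC.rpow_nonneg
  have hX : 0 ≤ R * A * R := (IsSelfAdjoint.of_nonneg hR0).conjugate_nonneg hA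
  have hXs := ((ContinuousLinearMap.nonneg_iff_isPositive _).1 hX).isSymmetric
  have hRs := ((ContinuousLinearMap.nonneg_iff_isPositive _).1 hR0).isSymmetric
  have hdim : Module.finrank ℂ (CSpace d) = d := by simp
  let e := hXs.eigenvectorBasis hdim
  have he : ∀ j, (R * A * R) (e j) = ((hXs.eigenvalues hdim j : ℝ) : ℂ) • e j :=
    fun j => hXs.apply_eigenvectorBasis hdim j
  let L : CSpace d ≃ₗ[ℂ] CSpace d := LinearEquiv.ofLinearMap (R : CSpace d →ₗ[ℂ] CSpace d)
    (S : CSpace d →ₗ[ℂ] CSpace d) (by ext1 v; exact congrArg (fun T : Op (CSpace d) => T v) hRS)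
    (by ext1 v; exact congrArg (fun T : Op (CSpace d) => T v) hSR)
  have hb : ∀ j, e.toBasis.map L j = R (e j) := fun j => by simp [L]
  have hBR : ∀ v, B (R v) = S v := by
    intro v
    rw [← hSS, mul_apply_eq_comp, ← mul_apply_eq_comp S R, hSR]
    rfl
  refine ⟨e.toBasis.map L, hXs.eigenvalues hdim, ?_, fun j => ?_, fun t j => ?_⟩
  · ext i j
    simp only [formMatrix, Matrix.of_apply, hb, hBR]
    have : inner ℂ (R (e i)) (S (e j)) = inner ℂ (e i) (R (S (e j))) := hRs _ _
    rw [this, ← mul_apply_eq_comp R S, hRS, Matrix.one_apply]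
    exact orthonormal_iff_ite.1 e.orthonormal i j
  · rw [hb, hBR, ← map_smul, ← he, ← mul_apply_eq_comp S, mul_assoc R, ← mul_assoc S,
      hSR, one_mul]
    rfl
  · have h1 : ((R * A * R) ^ t) (e j) = ((hXs.eigenvalues hdim j ^ t : ℝ) : ℂ) • e j := by
      rw [CFC.rpow_eq_cfc_real hX]
      exact cfc_apply_eigenvector (IsSelfAdjoint.of_nonneg hX) _ (he j)
    have h2 : S (R (e j)) = e j := congrArg (fun T : Op (CSpace d) => T (e j)) hSR
    rw [hb, hBR, ← map_smul, ← h1]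
    conv_rhs => rw [← h2]
    rfl

theorem injective_of_isStrictlyPositive {H : Type} [NormedAddCommGroup H] [InnerProductSpace ℂ H]
    [CompleteSpace H] {A : Op H} (hA : IsStrictlyPositive A) : Function.Injective A :=
  (ContinuousLinearMap.isUnit_iff_bijective.1 hA.isUnit).1

theorem isStrictlyPositive_of_injective {H : Type} [NormedAddCommGroup H] [InnerProductSpace ℂ H]
    [FiniteDimensional ℂ H] [CompleteSpace H] {A : Op H} (hA : 0 ≤ A)
    (h : Function.Injective A) : IsStrictlyPositive A :=
  ⟨hA, ContinuousLinearMap.isUnit_iff_bijective.2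
    ⟨h, LinearMap.injective_iff_surjective (f := (A : H →ₗ[ℂ] H)).1 h⟩⟩

/-! ### Scaling by scalars of the domain -/

namespace PositiveOperatorFunction

variable {Y : Type} {G : PositiveOperatorFunction Y}

theorem ScalarTensorMultiplicative.smul_mem_dom (hscal : G.ScalarTensorMultiplicative)
    {a : Y → ℂ} (ha : (fun y => a y • (1 : Op (CSpace 1))) ∈ G.dom 1) {d : ℕ}
    {A : Y → Op (CSpace d)} (hA : A ∈ G.dom d) :
    (fun y => a y • A y) ∈ G.dom d ∧
      G.toFun d (fun y => a y • A y) =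
        toScalar (G.toFun 1 fun y => a y • 1) • G.toFun d A := by
  have := hscal _ ha d A hA
  simpa only [toScalar_smul_one] using this

theorem ScalarTensorMultiplicative.smul_mem_domOn (hscal : G.ScalarTensorMultiplicative)
    {a : Y → ℂ} (ha : (fun y => a y • (1 : Op (CSpace 1))) ∈ G.dom 1) {H : Type}
    [NormedAddCommGroup H] [InnerProductSpace ℂ H] [FiniteDimensional ℂ H]
    {A : Y → Op H} (hA : A ∈ G.domOn H) :
    (fun y => a y • A y) ∈ G.domOn H ∧
      G.valOn (fun y => a y • A y) =
        toScalar (G.toFun 1 fun y => a y • 1) • G.valOn A := by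
  obtain ⟨d, V, hV⟩ := hA
  obtain ⟨h1, h2⟩ := hscal.smul_mem_dom ha hV
  have e : ∀ (z : ℂ) (T : Op H), unitaryConj V (z • T) = z • unitaryConj V T := by
    intro z T; ext x; simp
  have h3 : (fun y => a y • A y) ∈ G.domOn H := ⟨d, V, by simpa only [e] using h1⟩
  refine ⟨h3, ?_⟩
  rw [G.valOn_eq V _ h3, G.valOn_eq V A ⟨d, V, hV⟩]
  simp only [e]
  rw [h2]
  ext x; simp

theorem ScalarTensorMultiplicative.pow_smul_mem_domOn (hscal : G.ScalarTensorMultiplicative)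
    {a : Y → ℂ} (ha : (fun y => a y • (1 : Op (CSpace 1))) ∈ G.dom 1) {H : Type}
    [NormedAddCommGroup H] [InnerProductSpace ℂ H] [FiniteDimensional ℂ H]
    {A : Y → Op H} (hA : A ∈ G.domOn H) (n : ℕ) :
    (fun y => a y ^ n • A y) ∈ G.domOn H ∧
      G.valOn (fun y => a y ^ n • A y) =
        toScalar (G.toFun 1 fun y => a y • 1) ^ n • G.valOn A := by
  induction n with
  | zero => simpa using hA
  | succ n ih =>
    obtain ⟨h1, h2⟩ := hscal.smul_mem_domOn ha ih.1
    simp only [smul_smul, ← pow_succ'] at h1 h2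
    refine ⟨h1, ?_⟩
    rw [h2, ih.2, smul_smul, ← pow_succ']

/-- The product of `a` and its inverse is the constant family `1`, whose value is idempotent and
non-zero, hence one. -/
theorem toScalar_toFun_inv (hpos : G.StrictlyScalarPositive)
    (hscal : G.ScalarTensorMultiplicative) (hinv : G.ScalarDomainInvClosed) {a : Y → ℝ}
    (ha0 : ∀ y, 0 < a y) (ha : (fun y => (a y : ℂ) • (1 : Op (CSpace 1))) ∈ G.dom 1) :
    (fun y => (((a y)⁻¹ : ℝ) : ℂ) • (1 : Op (CSpace 1))) ∈ G.dom 1 ∧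
      toScalar (G.toFun 1 fun y => (a y : ℂ) • 1) *
        toScalar (G.toFun 1 fun y => (((a y)⁻¹ : ℝ) : ℂ) • 1) = 1 := by
  have h1 := hinv a ha0 ha
  refine ⟨h1, ?_⟩
  obtain ⟨h2, h3⟩ := hscal.smul_mem_dom ha h1
  have e : (fun y => (a y : ℂ) • (((a y)⁻¹ : ℝ) : ℂ) • (1 : Op (CSpace 1))) =
      fun y => (1 : ℂ) • 1 := by
    funext y
    rw [smul_smul, ← Complex.ofReal_mul, mul_inv_cancel₀ (ha0 y).ne', Complex.ofReal_one]
  rw [e] at h2 h3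
  obtain ⟨-, h4⟩ := hscal.smul_mem_dom h2 h2
  have h5 : toScalar (G.toFun 1 fun _ => (1 : ℂ) • 1) ≠ 0 := by
    intro h0
    have hp := hpos _ ⟨h2, fun y => by rw [one_smul]; exact isStrictlyPositive_one⟩
    rw [op_cspace_one_eq (G.toFun 1 _), h0, zero_smul] at hp
    exact not_isUnit_zero hp.isUnit
  have hmul : ∀ (z : ℂ) (T : Op (CSpace 1)), toScalar (z • T) = z * toScalar T := fun _ _ => rfl
  have h6 := congrArg toScalar h3
  have h7 := congrArg toScalar h4
  simp only [one_smul, hmul] at h5 h6 h7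
  rw [← h6]
  exact (mul_eq_left₀ h5).1 h7.symm

/-- Testing the arithmetic mean bound of a scaled tensor power on product vectors. -/
theorem prod_inner_le [Fintype Y] (hpos : G.StrictlyScalarPositive)
    (htens : G.TensorMultiplicative) (hscal : G.ScalarTensorMultiplicative)
    (hAM : G.AsymptoticallyIndividuallyAMBounded) (hblock : G.BlockAdditive)
    (hred : G.ReductionProperty) (hinv : G.ScalarDomainInvClosed) {d : ℕ}
    {A : Y → Op (CSpace d)} (hA : A ∈ G.dom d) {D : Y → ℝ} (hD0 : ∀ y, 0 < D y)
    (hD : ∀ y, (opMatrix (A y)).det = D y) {g : ℝ} (hg : (opMatrix (G.toFun d A)).det = g) :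
    g ≠ 0 ∧ ∀ (N : ℕ), 1 ≤ N → ∀ (n : ℕ) (w : Fin N → CSpace d) (u : Fin N → ℝ)
      (p : Y → Fin N → ℝ), (∀ k, inner ℂ (w k) (G.toFun d A (w k)) = u k) →
      (∀ y k, inner ℂ (w k) (A y (w k)) = p y k) →
      ∀ M : ℝ, 0 ≤ M → (∀ y, (D y)⁻¹ ^ n * ∏ k, p y k ≤ M) → g⁻¹ ^ n * ∏ k, u k ≤ M := by
  obtain ⟨h1, h2⟩ := toScalar_toFun_det htens hblock hred hA
  simp only [hD] at h1 h2
  rw [hg] at h2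
  obtain ⟨h3, h4⟩ := toScalar_toFun_inv hpos hscal hinv hD0 h1
  rw [h2] at h4
  have hg0 : (g : ℂ) ≠ 0 := left_ne_zero_of_mul_eq_one h4
  have h5 := eq_inv_of_mul_eq_one_right h4
  refine ⟨by exact_mod_cast hg0, fun N hN n w u p hu hp M hM0 hM => ?_⟩
  obtain ⟨h6, h7⟩ := htens d A hA N hN
  -- The number `n` of divisions by the determinants is independent of the tensor degree `N`.
  obtain ⟨h8, h9⟩ := hscal.pow_smul_mem_domOn h3 h6 n
  refine hAM.inner_valOn_le h8 (tensorVec w) (p := fun y => (D y)⁻¹ ^ n * ∏ k, p y k)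
    ?_ (fun y => ?_) hM0 hM
  · rw [h9, h7, h5, smul_apply, inner_smul_right, tensorPow_tensorVec, inner_tensorVec]
    simp [hu]
  · rw [smul_apply, inner_smul_right, tensorPow_tensorVec, inner_tensorVec]
    simp [hp]

end PositiveOperatorFunction

/-- The word lists each letter `j` exactly `q j` times. -/
theorem exists_word {d : ℕ} (q : Fin d → ℕ) :
    ∃ i : Fin (∑ j, q j) → Fin d, ∀ f : Fin d → ℝ, ∏ k, f (i k) = ∏ j, f j ^ q j := by
  refine ⟨fun k => (finSigmaFinEquiv.symm k).1, fun f => ?_⟩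
  rw [Equiv.prod_comp finSigmaFinEquiv.symm (fun z : (j : Fin d) × Fin (q j) => f z.1),
    Fintype.prod_sigma]
  simp

/-! ### The exponent of a single pair -/

namespace PositiveOperatorFunction

variable {G : PositiveOperatorFunction (Fin 2)}

open scoped ComplexOrder in
theorem exists_exponent_single (hpos : G.StrictlyScalarPositive)
    (htens : G.TensorMultiplicative) (hscal : G.ScalarTensorMultiplicative)
    (hAM : G.AsymptoticallyIndividuallyAMBounded) (hblock : G.BlockAdditive)
    (hred : G.ReductionProperty) (hinv : G.ScalarDomainInvClosed) {d : ℕ}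
    {A : Fin 2 → Op (CSpace d)} (hA : A ∈ G.domPos d) :
    ∃ t ∈ Set.Icc (0 : ℝ) 1, ∀ (v : CSpace d) (x : ℝ), A 0 v = (x : ℂ) • A 1 v →
      G.toFun d A v = ((x ^ t : ℝ) : ℂ) • A 1 v := by
  obtain ⟨b, x, hb1, hbA, -⟩ := exists_basis_simultaneous (hA.2 1) (hA.2 0).nonneg
  have hb0 : formMatrix (A 0) b = Matrix.diagonal fun j => (x j : ℂ) := by
    ext i j
    have := congrFun (congrFun hb1 i) j
    simp only [formMatrix, Matrix.of_apply] at this ⊢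
    rw [hbA, inner_smul_right, this, Matrix.one_apply, Matrix.diagonal_apply]
    rcases eq_or_ne i j with rfl | hij
    · simp
    · simp [hij]
  have hx : ∀ j, 0 < x j := by
    intro j
    have h1 := ((ContinuousLinearMap.nonneg_iff_isPositive _).1
      (hA.2 0).nonneg).inner_nonneg_right (b j)
    have h2 := congrFun (congrFun hb0 j) j
    simp only [formMatrix, Matrix.of_apply, Matrix.diagonal_apply_eq] at h2
    rw [h2] at h1
    refine lt_of_le_of_ne (by exact_mod_cast h1) fun h3 => b.ne_zero j ?_
    refine injective_of_isStrictlyPositive (hA.2 0) ?_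
    rw [hbA, ← h3]
    simp
  set s : ℝ := Complex.normSq (Matrix.det (Matrix.of fun i j => b j i)) with hs
  have hdet1 := det_formMatrix (A 1) b
  have hdet0 := det_formMatrix (A 0) b
  have hdetG := det_formMatrix (G.toFun d A) b
  rw [← hs] at hdet1 hdet0 hdetG
  rw [hb1, Matrix.det_one] at hdet1
  rw [hb0, Matrix.det_diagonal] at hdet0
  have hs0 : s ≠ 0 := by
    intro h
    rw [h] at hdet1
    simp at hdet1
  have hsC : (s : ℂ) ≠ 0 := by exact_mod_cast hs0
  have hspos : 0 < s := lt_of_le_of_ne (Complex.normSq_nonneg _) hs0.symm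
  have hxpos : 0 < ∏ j, x j := Finset.prod_pos fun j _ => hx j
  have hps := posSemidef_formMatrix (G.nonneg hA.1) b
  obtain ⟨q, hq0, hq⟩ : ∃ q : ℝ, 0 ≤ q ∧ (formMatrix (G.toFun d A) b).det = q :=
    ⟨_, (Complex.nonneg_iff.1 hps.det_nonneg).1,
      Complex.ext rfl (Complex.nonneg_iff.1 hps.det_nonneg).2.symm⟩
  have hy : ∀ i, ∃ y : ℝ, 0 ≤ y ∧ formMatrix (G.toFun d A) b i i = y := fun i =>
    ⟨_, (Complex.nonneg_iff.1 (hps.diag_nonneg (i := i))).1,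
      Complex.ext rfl (Complex.nonneg_iff.1 (hps.diag_nonneg (i := i))).2.symm⟩
  choose y hy0 hy using hy
  -- The determinants of the operators are those of their form matrices divided by `s`.
  obtain ⟨hg0, hword⟩ := prod_inner_le hpos htens hscal hAM hblock hred hinv hA.1
    (D := ![s⁻¹ * ∏ j, x j, s⁻¹]) (g := s⁻¹ * q) (by
      intro i; fin_cases i
      · exact mul_pos (inv_pos.2 hspos) hxpos
      · exact inv_pos.2 hspos) (by
      intro i; fin_cases i
      · simp only [Fin.zero_eta, Matrix.cons_val_zero]
        push_cast
        rw [hdet0, inv_mul_cancel_left₀ hsC]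
      · simp only [Fin.mk_one, Matrix.cons_val_one, Matrix.cons_val_fin_one]
        push_cast
        exact eq_inv_of_mul_eq_one_right hdet1.symm) (by
      push_cast
      rw [← hq, hdetG, inv_mul_cancel_left₀ hsC])
  have hq_ne : q ≠ 0 := right_ne_zero_of_mul hg0
  have hqpos : 0 < q := lt_of_le_of_ne hq0 hq_ne.symm
  have hpd : (formMatrix (G.toFun d A) b).PosDef :=
    hps.posDef_iff_det_ne_zero.2 (by rw [hq]; exact_mod_cast hq_ne)
  have hypos : ∀ i, 0 < y i := by
    intro i
    have := hpd.diag_pos (i := i)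
    rw [hy] at this
    exact_mod_cast this
  have hword' : ∀ (N : ℕ), 1 ≤ N → ∀ (n : ℕ) (i : Fin N → Fin d),
      ∏ k, y (i k) ≤ q ^ n * max ((∏ j, x j)⁻¹ ^ n * ∏ k, x (i k)) 1 := by
    intro N hN n i
    have h1 := hword N hN n (fun k => b (i k)) (fun k => y (i k))
      ![fun k => x (i k), fun _ => 1] (fun k => hy (i k)) (by
        intro j k; fin_cases j
        · exact (congrFun (congrFun hb0 (i k)) (i k)).trans (Matrix.diagonal_apply_eq _ _)
        · refine (congrFun (congrFun hb1 (i k)) (i k)).trans ?_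
          simp)
      (s ^ n * max ((∏ j, x j)⁻¹ ^ n * ∏ k, x (i k)) 1) (by positivity) (by
        intro j; fin_cases j
        · simp only [Fin.zero_eta, Matrix.cons_val_zero, mul_inv, inv_inv, mul_pow, mul_assoc]
          gcongr
          exact le_max_left _ _
        · simp only [Fin.mk_one, Matrix.cons_val_one, Matrix.cons_val_fin_one, inv_inv,
            Finset.prod_const_one]
          gcongr
          exact le_max_right _ _)
    -- The factor `s ^ n` occurs on both sides and cancels.
    rw [mul_inv, inv_inv, mul_pow, mul_assoc, mul_le_mul_iff_right₀ (by positivity), inv_pow,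
      inv_mul_le_iff₀ (by positivity)] at h1
    exact h1
  -- Each index used once and one division by the determinants make both entries of the maximum
  -- equal to one.
  have hprod : ∏ j, y j ≤ q := by
    have := hword' d (G.dim_pos hA.1) 1 id
    simpa [inv_mul_cancel₀ hxpos.ne'] using this
  have hdiag := hps.eq_diagonal_of_prod_le_det hypos hy (by rw [hq]; exact_mod_cast hprod)
  have hqy : q = ∏ j, y j := by
    have := hq
    rw [hdiag, Matrix.det_diagonal] at this
    exact_mod_cast this.symm
  let f : (Fin d → ℤ) →+ ℝ := ∑ j,
    (zmultiplesHom ℝ (Real.log (y j))).comp (Pi.evalAddMonoidHom _ j)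
  let l : (Fin d → ℤ) →+ ℝ := ∑ j,
    (zmultiplesHom ℝ (Real.log (x j))).comp (Pi.evalAddMonoidHom _ j)
  have hf : ∀ v, f v = ∑ j, v j * Real.log (y j) := fun v => by simp [f]
  have hl : ∀ v, l v = ∑ j, v j * Real.log (x j) := fun v => by simp [l]
  obtain ⟨t, ht, hft⟩ := exists_slope_of_le_max f l (by
    intro v
    -- A shift by `n` makes all exponents positive; the extra one keeps the word non-empty even for
    -- `v = 0`.
    let n : ℕ := ∑ j, (v j).natAbs + 1
    have hvn : ∀ j, 0 < v j + n := by
      intro j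
      have h1 : (v j).natAbs ≤ ∑ j, (v j).natAbs :=
        Finset.single_le_sum (f := fun j => (v j).natAbs) (fun _ _ => Nat.zero_le _)
          (Finset.mem_univ j)
      simp only [n]
      omega
    let e : Fin d → ℕ := fun j => (v j + n).toNat
    have he : ∀ j, (e j : ℝ) = v j + n := by
      intro j
      have : ((e j : ℕ) : ℤ) = v j + n := Int.toNat_of_nonneg (hvn j).le
      exact_mod_cast this
    obtain ⟨i, hi⟩ := exists_word e
    have hN : 1 ≤ ∑ j, e j := by
      have h0 : 0 < e ⟨0, G.dim_pos hA.1⟩ := by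
        have := hvn ⟨0, G.dim_pos hA.1⟩
        simp only [e]
        omega
      exact h0.trans_le (Finset.single_le_sum (f := e) (fun _ _ => Nat.zero_le _)
        (Finset.mem_univ _))
    have h1 := hword' _ hN n i
    rw [hi y, hi x] at h1
    have h2 : 0 < ∏ j, x j ^ e j := Finset.prod_pos fun j _ => pow_pos (hx j) _
    have hlogpow : ∀ z : Fin d → ℝ, (∀ j, 0 < z j) →
        Real.log (∏ j, z j ^ e j) = ∑ j, v j * Real.log (z j) + n * Real.log (∏ j, z j) := by
      intro z hz
      rw [Real.log_prod fun j _ => (pow_pos (hz j) _).ne', Real.log_prod fun j _ => (hz j).ne',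
        Finset.mul_sum, ← Finset.sum_add_distrib]
      refine Finset.sum_congr rfl fun j _ => ?_
      rw [Real.log_pow, he]
      ring
    have h3 := Real.log_le_log (Finset.prod_pos fun j _ => pow_pos (hypos j) _) h1
    rw [hlogpow y hypos, Real.log_mul (by positivity) (by positivity), Real.log_pow, hqy,
      add_comm, add_le_add_iff_left, ← hf] at h3
    refine h3.trans ?_
    rcases le_total ((∏ j, x j)⁻¹ ^ n * ∏ j, x j ^ e j) 1 with h4 | h4
    · rw [max_eq_right h4, Real.log_one]
      exact le_max_right _ _
    · rw [max_eq_left h4, Real.log_mul (by positivity) h2.ne', hlogpow x hx, Real.log_pow,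
        Real.log_inv, hl]
      refine le_trans (le_of_eq ?_) (le_max_left _ _)
      ring)
  have hyx : ∀ j, y j = x j ^ t := by
    intro j
    have h1 := hft (Pi.single j 1)
    rw [hf, hl, Finset.sum_eq_single j, Finset.sum_eq_single j] at h1
    · simp only [Pi.single_eq_same, Int.cast_one, one_mul] at h1
      rw [Real.rpow_def_of_pos (hx j), mul_comm, ← h1, Real.exp_log (hypos j)]
    all_goals intros; simp_all
  have hGb : ∀ j, G.toFun d A (b j) = ((x j ^ t : ℝ) : ℂ) • A 1 (b j) := by
    intro j
    refine InnerProductSpace.ext_inner_left_basis b fun i => ?_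
    have h1 := congrFun (congrFun hdiag i) j
    have h2 := congrFun (congrFun hb1 i) j
    simp only [formMatrix, Matrix.of_apply] at h1 h2
    rw [h1, inner_smul_right, h2, Matrix.diagonal_apply, Matrix.one_apply, ← hyx]
    rcases eq_or_ne i j with rfl | hij
    · simp
    · simp [hij]
  refine ⟨t, ht, fun v z hv => ?_⟩
  -- Since `A 1` is injective, only basis vectors with `x j = z` occur in `v`.
  have hcoef : ∀ j, b.repr v j * ((x j : ℂ) - z) = 0 := by
    intro j
    have h1 : A 1 (∑ j, (b.repr v j * ((x j : ℂ) - z)) • b j) = A 1 0 := by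
      rw [map_zero, ← sub_eq_zero.2 hv]
      conv_rhs => rw [← b.sum_repr v]
      simp only [map_sum, map_smul, hbA, Finset.smul_sum, ← Finset.sum_sub_distrib]
      refine Finset.sum_congr rfl fun j _ => ?_
      module
    have h2 := injective_of_isStrictlyPositive (hA.2 1) h1
    exact Fintype.linearIndependent_iff.1 b.linearIndependent _ h2 j
  rw [← b.sum_repr v]
  simp only [map_sum, map_smul, hGb, Finset.smul_sum]
  refine Finset.sum_congr rfl fun j _ => ?_
  rcases mul_eq_zero.1 (hcoef j) with h | h
  · simp [h]
  · have : x j = z := by exact_mod_cast sub_eq_zero.1 h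
    rw [this, smul_comm]

end PositiveOperatorFunction

/-! ### A common exponent for all pairs -/

theorem ofReal_smul_one_eq_algebraMap {d : ℕ} (r : ℝ) :
    (r : ℂ) • (1 : Op (CSpace d)) = algebraMap ℝ (Op (CSpace d)) r := by
  rw [Algebra.algebraMap_eq_smul_one]
  rfl

theorem isStrictlyPositive_ofReal_smul_one {d : ℕ} {r : ℝ} (hr : 0 < r) :
    IsStrictlyPositive ((r : ℂ) • (1 : Op (CSpace d))) := by
  rw [ofReal_smul_one_eq_algebraMap]
  exact isStrictlyPositive_algebraMap hr

namespace PositiveOperatorFunction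

variable {G : PositiveOperatorFunction (Fin 2)}

/-- The exponent of the direct sum of the pairs serves every summand. -/
theorem exists_exponent_finite (hpos : G.StrictlyScalarPositive)
    (htens : G.TensorMultiplicative) (hscal : G.ScalarTensorMultiplicative)
    (hAM : G.AsymptoticallyIndividuallyAMBounded) (hblock : G.BlockAdditive)
    (hred : G.ReductionProperty) (hinv : G.ScalarDomainInvClosed) {r : ℕ} (hr : 1 ≤ r)
    (p : Fin r → Σ d, Fin 2 → Op (CSpace d)) (hp : ∀ i, (p i).2 ∈ G.domPos (p i).1) :
    ∃ t ∈ Set.Icc (0 : ℝ) 1, ∀ (i : Fin r) (v : CSpace (p i).1) (x : ℝ),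
      (p i).2 0 v = (x : ℂ) • (p i).2 1 v →
        G.toFun (p i).1 (p i).2 v = ((x ^ t : ℝ) : ℂ) • (p i).2 1 v := by
  have hB : ∀ i, (p i).2 ∈ G.domOn (CSpace (p i).1) := fun i =>
    ⟨_, LinearIsometryEquiv.refl ℂ _, (hp i).1⟩
  have hdom := (hblock r hr (fun i => CSpace (p i).1) (fun i => (p i).2) hB).1
  have hdom' := hdom
  obtain ⟨D, V, hV⟩ := hdom'
  have hinj : ∀ y, Function.Injective
      (unitaryConj V (directSumOp fun i => (p i).2 y)) := by
    intro y
    have hdir : Function.Injective (directSumOp fun i => (p i).2 y) := by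
      intro v w hvw
      ext1 i
      exact injective_of_isStrictlyPositive ((hp i).2 y)
        (congrArg (fun z : PiLp 2 fun i => CSpace (p i).1 => z i) hvw)
    exact V.injective.comp (hdir.comp V.symm.injective)
  obtain ⟨t, ht, h⟩ := exists_exponent_single hpos htens hscal hAM hblock hred hinv
    (A := fun y => unitaryConj V (directSumOp fun i => (p i).2 y))
    ⟨hV, fun y => isStrictlyPositive_of_injective (G.nonneg_of_mem_dom hV y) (hinj y)⟩
  refine ⟨t, ht, fun i v x hv => ?_⟩
  have hsingle : ∀ y, directSumOp (fun i => (p i).2 y) (PiLp.single 2 i v) =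
      PiLp.single 2 i ((p i).2 y v) := by
    intro y
    ext1 j
    rw [directSumOp_apply]
    rcases eq_or_ne j i with rfl | hj
    · simp
    · simp [Pi.single_eq_of_ne hj]
  have hsmul : ∀ (c : ℂ) (w : CSpace (p i).1), (PiLp.single 2 i (c • w) :
      PiLp 2 fun i => CSpace (p i).1) = c • PiLp.single 2 i w := by
    intro c w
    ext1 j
    rcases eq_or_ne j i with rfl | hj
    · simp
    · simp [Pi.single_eq_of_ne hj]
  have h1 := h (V (PiLp.single 2 i v)) x (by
    simp only [unitaryConj_apply, V.symm_apply_apply, hsingle]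
    rw [← map_smul, hv, hsmul])
  have h2 := valOn_apply_single hblock hB i v
  rw [G.valOn_eq V _ hdom, unitaryConj_apply, LinearIsometryEquiv.symm_symm, h1,
    unitaryConj_apply, V.symm_apply_apply, hsingle, ← map_smul, V.symm_apply_apply,
    ← hsmul, valOn_eq_toFun (hp i).1] at h2
  have h3 := congrArg (fun z : PiLp 2 fun i => CSpace (p i).1 => z i) h2
  simpa using h3.symm

theorem exists_exponent (hpos : G.StrictlyScalarPositive)
    (htens : G.TensorMultiplicative) (hscal : G.ScalarTensorMultiplicative)
    (hAM : G.AsymptoticallyIndividuallyAMBounded) (hblock : G.BlockAdditive)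
    (hred : G.ReductionProperty) (hinv : G.ScalarDomainInvClosed) :
    ∃ t ∈ Set.Icc (0 : ℝ) 1, ∀ (d : ℕ), ∀ A ∈ G.domPos d, ∀ (v : CSpace d) (x : ℝ),
      A 0 v = (x : ℂ) • A 1 v → G.toFun d A v = ((x ^ t : ℝ) : ℂ) • A 1 v := by
  -- A single ratio `x ≠ 1` determines `t` through `x ^ t`; every other pair is then compared with
  -- this one in a direct sum. If all ratios are one, any exponent works.
  by_cases hex : ∃ (d : ℕ) (A : Fin 2 → Op (CSpace d)) (v : CSpace d) (x : ℝ),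
      A ∈ G.domPos d ∧ v ≠ 0 ∧ 0 < x ∧ x ≠ 1 ∧ A 0 v = (x : ℂ) • A 1 v
  · obtain ⟨d, A, v, x, hA, hv, hx, hx1, hvx⟩ := hex
    obtain ⟨t, ht, h⟩ := exists_exponent_single hpos htens hscal hAM hblock hred hinv hA
    refine ⟨t, ht, fun e B hB => ?_⟩
    obtain ⟨t', -, h'⟩ := exists_exponent_finite hpos htens hscal hAM hblock hred hinv
      one_le_two ![⟨d, A⟩, ⟨e, B⟩] (Fin.forall_fin_two.2 ⟨hA, hB⟩)
    have hA' := h' 0 v x hvx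
    have hAv : A 1 v ≠ 0 := fun h0 => hv
      (injective_of_isStrictlyPositive (hA.2 1) (h0.trans (map_zero _).symm))
    have h1 : ((x ^ t' : ℝ) : ℂ) = ((x ^ t : ℝ) : ℂ) :=
      smul_left_injective ℂ hAv (hA'.symm.trans (h v x hvx))
    have h2 : t' = t := by
      have := congrArg Real.log (Complex.ofReal_injective h1)
      rw [Real.log_rpow hx, Real.log_rpow hx] at this
      exact mul_right_cancel₀ (Real.log_ne_zero_of_pos_of_ne_one hx hx1) this
    rw [← h2]
    exact h' 1
  · push Not at hex
    refine ⟨0, by simp, fun d A hA v x hvx => ?_⟩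
    obtain ⟨t, -, h⟩ := exists_exponent_single hpos htens hscal hAM hblock hred hinv hA
    rcases eq_or_ne v 0 with rfl | hv
    · simp
    -- For `x ≤ 0` the operator `A 0 - x A 1` would be strictly positive and yet annihilate `v`.
    have hx : 0 < x := by
      by_contra! hx
      have h1 : IsStrictlyPositive (A 0 + (-x) • A 1) :=
        (hA.2 0).add_nonneg (smul_nonneg (neg_nonneg.2 hx) (hA.2 1).nonneg)
      refine hv (injective_of_isStrictlyPositive h1 ?_)
      rw [map_zero, add_apply, smul_apply, hvx, neg_smul]
      exact add_neg_cancel _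
    have hx1 : x = 1 := by
      by_contra hx1
      exact hex d A v x hA hv hx hx1 hvx
    rw [h v x hvx, hx1, Real.one_rpow, Real.one_rpow]

theorem toFun_eq_kuboAndo {d : ℕ} {A : Fin 2 → Op (CSpace d)} (hA : A ∈ G.domPos d) {t : ℝ}
    (h : ∀ (v : CSpace d) (x : ℝ), A 0 v = (x : ℂ) • A 1 v →
      G.toFun d A v = ((x ^ t : ℝ) : ℂ) • A 1 v) :
    G.toFun d A = kuboAndo t (A 1) (A 0) := by
  obtain ⟨b, x, -, hbA, hbK⟩ := exists_basis_simultaneous (hA.2 1) (hA.2 0).nonneg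
  refine ContinuousLinearMap.coe_injective (b.ext fun j => ?_)
  exact (h (b j) (x j) (hbA j)).trans (hbK t j).symm

theorem isKuboAndo_toFun {t : ℝ}
    (h : ∀ (d : ℕ), ∀ A ∈ G.domPos d, G.toFun d A = kuboAndo t (A 1) (A 0)) (hreg : G.Regular)
    {d : ℕ} {A : Fin 2 → Op (CSpace d)} (hA : A ∈ G.dom d) :
    IsKuboAndo t (A 1) (A 0) (G.toFun d A) := by
  obtain ⟨⟨δ, hδ, hdom⟩, hlim⟩ := hreg d A hA
  refine hlim.congr' ?_
  filter_upwards [Ioo_mem_nhdsGT hδ] with ε hε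
  refine h d _ ⟨hdom ε hε, fun y => ?_⟩
  exact IsStrictlyPositive.nonneg_add (G.nonneg_of_mem_dom hA y)
    (isStrictlyPositive_ofReal_smul_one hε.1)

theorem IsWeightedGeometricMean.scalarDomainInvClosed {ν : Fin 2 → ℝ}
    (hν : G.IsWeightedGeometricMean ν) : G.ScalarDomainInvClosed := by
  intro a ha _
  exact (hν 1 le_rfl _ (fun y => isStrictlyPositive_ofReal_smul_one (inv_pos.2 (ha y)))
    fun y z => (Commute.one_left _).smul_left _).1

/-- The scalar pair `(2, 1)` already determines the exponent: `2 ^ t = 2 ^ ν 0`. -/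
theorem IsWeightedGeometricMean.exponent_eq {ν : Fin 2 → ℝ} (hν : G.IsWeightedGeometricMean ν)
    {t : ℝ} (h : ∀ (d : ℕ), ∀ A ∈ G.domPos d, ∀ (v : CSpace d) (x : ℝ),
      A 0 v = (x : ℂ) • A 1 v → G.toFun d A v = ((x ^ t : ℝ) : ℂ) • A 1 v) : t = ν 0 := by
  have ha : ∀ y, (0 : ℝ) < (![2, 1] : Fin 2 → ℝ) y := by
    intro y; fin_cases y <;> simp
  have hA : ∀ y, IsStrictlyPositive
      ((((![2, 1] : Fin 2 → ℝ) y : ℝ) : ℂ) • (1 : Op (CSpace 1))) :=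
    fun y => isStrictlyPositive_ofReal_smul_one (ha y)
  obtain ⟨h1, h2⟩ := hν 1 le_rfl (fun y => (((![2, 1] : Fin 2 → ℝ) y : ℝ) : ℂ) • 1) hA
    fun y z => (Commute.one_left _).smul_left _
  have h3 := h 1 _ ⟨h1, hA⟩ (EuclideanSpace.single 0 1) 2 (by simp)
  have hsum : ∑ y, (ν y : ℂ) • CFC.log ((((![2, 1] : Fin 2 → ℝ) y : ℝ) : ℂ) •
      (1 : Op (CSpace 1))) = algebraMap ℂ _ ((ν 0 * Real.log 2 : ℝ) : ℂ) := by
    simp only [ofReal_smul_one_eq_algebraMap, CFC.log_algebraMap, Fin.sum_univ_two,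
      Matrix.cons_val_zero, Matrix.cons_val_one, Matrix.cons_val_fin_one, Real.log_one, map_zero,
      smul_zero, add_zero]
    rw [← ofReal_smul_one_eq_algebraMap, smul_smul, Algebra.algebraMap_eq_smul_one,
      Complex.ofReal_mul]
  rw [h2, hsum, ← NormedSpace.algebraMap_exp_comm, ← Complex.exp_eq_exp_ℂ, ← Complex.ofReal_exp,
    Algebra.algebraMap_eq_smul_one] at h3
  have h4 := congrArg (fun v : CSpace 1 => v 0) h3
  have h5 : ((Real.exp (ν 0 * Real.log 2) : ℝ) : ℂ) = ((2 ^ t : ℝ) : ℂ) := by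
    simpa using h4
  have h6 := congrArg Real.log (Complex.ofReal_injective h5)
  rw [Real.log_exp, Real.log_rpow two_pos] at h6
  exact (mul_right_cancel₀ (Real.log_pos one_lt_two).ne' h6).symm

end PositiveOperatorFunction

end

theorem mainTheorem4 (G : PositiveOperatorFunction (Fin 2))
    (hpos : G.StrictlyScalarPositive)
    (htens : G.TensorMultiplicative)
    (hscal : G.ScalarTensorMultiplicative)
    (hAM : G.AsymptoticallyIndividuallyAMBounded)
    (hblock : G.BlockAdditive)
    (hred : G.ReductionProperty) :
    (G.ScalarDomainInvClosed →
      ∃ t ∈ Set.Icc (0 : ℝ) 1,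
        (∀ (d : ℕ), ∀ A ∈ G.domPos d, G.toFun d A = kuboAndo t (A 1) (A 0)) ∧
        (G.Regular → ∀ (d : ℕ), ∀ A ∈ G.dom d, IsKuboAndo t (A 1) (A 0) (G.toFun d A))) ∧
    (∀ ν ∈ stdSimplex ℝ (Fin 2), G.IsWeightedGeometricMean ν →
      (∀ (d : ℕ), ∀ A ∈ G.domPos d, G.toFun d A = kuboAndo (ν 0) (A 1) (A 0)) ∧
      (G.Regular → ∀ (d : ℕ), ∀ A ∈ G.dom d,
        IsKuboAndo (ν 0) (A 1) (A 0) (G.toFun d A))) := by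
  refine ⟨fun hinv => ?_, fun ν _ hmean => ?_⟩
  · obtain ⟨t, ht, h⟩ := PositiveOperatorFunction.exists_exponent hpos htens hscal hAM hblock
      hred hinv
    have hK : ∀ (d : ℕ), ∀ A ∈ G.domPos d, G.toFun d A = kuboAndo t (A 1) (A 0) :=
      fun d A hA => PositiveOperatorFunction.toFun_eq_kuboAndo hA (h d A hA)
    exact ⟨t, ht, hK, fun hreg d A hA => PositiveOperatorFunction.isKuboAndo_toFun hK hreg hA⟩
  · obtain ⟨t, -, h⟩ := PositiveOperatorFunction.exists_exponent hpos htens hscal hAM hblock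
      hred hmean.scalarDomainInvClosed
    obtain rfl := hmean.exponent_eq h
    have hK : ∀ (d : ℕ), ∀ A ∈ G.domPos d, G.toFun d A = kuboAndo (ν 0) (A 1) (A 0) :=
      fun d A hA => PositiveOperatorFunction.toFun_eq_kuboAndo hA (h d A hA)
    exact ⟨hK, fun hreg d A hA => PositiveOperatorFunction.isKuboAndo_toFun hK hreg hA⟩
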